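/- **Access control logics.** Fix a set of atomic propositions $p$ and, distinct from it, a set of atomic principals $a$. * $ICL$-formulas are $s,t ::= p \mid s\wedge t\mid s\vee t\mid s\supset t\mid \bot\mid\top\mid A\ \mathtt{says}\ s$, with $A$ an atomic principal. $\vdash s$ in $ICL$ means derivability in a Hilbert system for intuitionistic propositional logic (rule: modus ponens) with the additional axiom schemes $s\supset (A\ \mathtt{says}\ s)$; $(A\ \mathtt{says}\ (s\supset t))\supset (A\ \mathtt{says}\ s)\supset (A\ \mathtt{says}\ t)$; $(A\ \mathtt{says}\ A\ \mathtt{says}\ s)\supset (A\ \mathtt{says}\ s)$. * $ICL^{\Rightarrow}$ adds the formulas $A\Rightarrow B$ ($A,B$ atomic principals) and the axiom schemes $A\Rightarrow A$; $(A\Rightarrow B)\supset(B\Rightarrow C)\supset(A\Rightarrow C)$; $(A\Rightarrow B)\supset(A\ \mathtt{says}\ s)\supset(B\ \mathtt{says}\ s)$; $(B\ \mathtt{says}\ (A\Rightarrow B))\supset (A\Rightarrow B)$. * $ICL^{B}$ is $ICL$ with principals $A,B ::= a\mid A\wedge B\mid A\vee B\mid A\supset B\mid\bot\mid\top$ and the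 additional axiom schemes $(\bot\ \mathtt{says}\ s)\supset s$; $A\ \mathtt{says}\ \bot$ whenever $A\equiv\top$ in classical propositional logic; $((A\supset B)\ \mathtt{says}\ s)\supset(A\ \mathtt{says}\ s)\supset(B\ \mathtt{says}\ s)$. **Simple type theory.** Types are generated from $o,\iota$ by $\to$. Terms are built from typed variables and constants by $\lambda$-abstraction, application, $\neg$, $\vee$ and $\Pi_{(\alpha\to o)\to o}$; $\forall X_\alpha. s$ is $\Pi(\lambda X_\alpha. s)$, and $\Rightarrow,\wedge,\top,\bot$ are defined as usual. The constants are $p_{\iota\to o}$ for each atomic proposition $p$, a different $a_{\iota\to o}$ for each atomic principal $a$, and $r_{\iota\to\iota\to o}$. A Henkin model consists of non-empty domains $D_\alpha$ with $D_o=\{T,F\}$ and $D_{\alpha\to\beta}$ a set of functions from $D_\alpha$ to $D_\beta$, together with denotations of the constants, such that every term has a value in the domain of its type under every variable assignment (variables, constants, application, abstraction and the logical connectives being interpreted as usual). $\Gamma\models A$ means that $A$ is valid (true under all assignments) in every Henkin model in which all members of $\Gamma$ are valid. **Embedding.** Put $|\vee|=\lambda A.\lambda B.\lambda X.\,A X\vee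 B X$, $|\wedge|=\lambda A.\lambda B.\lambda X.\,A X\wedge B X$, $|\supset|=\lambda A.\lambda B.\lambda X.\,A X\Rightarrow B X$, $|\top|=\lambda X.\top$, $|\bot|=\lambda X.\bot$ and $|\Box_r|=\lambda A.\lambda X.\forall Y.\,r X Y\Rightarrow A Y$ (with $A,B$ of type $\iota\to o$ and $X,Y$ of type $\iota$), and write modal formulas inside $|\cdot|$ for the corresponding terms. Let $\mathrm{Mval}=\lambda A.\forall W_\iota.\,A W$, $$\mathtt R=\forall X_{\iota\to o}.\ \mathrm{Mval}\,|\Box_r X\supset X|,\qquad \mathtt T=\forall X_{\iota\to o}.\ \mathrm{Mval}\,|\Box_r X\supset\Box_r\Box_r X|.$$ Let $\|\cdot\|$ map formulas to terms of type $\iota\to o$ by applying to the translated arguments the terms $\|p\|=|\Box_r p|$, $\|\wedge\|=\lambda S.\lambda T.|S\wedge T|$, $\|\vee\|=\lambda S.\lambda T.|S\vee T|$, $\|\supset\|=\lambda S.\lambda T.|\Box_r(S\supset T)|$, $\|\top\|=|\top|$, $\|\bot\|=|\bot|$, $\|\mathtt{says}\|=\lambda A.\lambda S.|\Box_r(A\vee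 S)|$, $\|\Rightarrow\|=\lambda A.\lambda B.|\Box_r(A\supset B)|$. An atomic principal $a$ is mapped to $a_{\iota\to o}$, and a Boolean principal of $ICL^B$ is mapped connective by connective to the corresponding Boolean modal expression, with $|\wedge|,|\vee|,|\supset|,|\bot|,|\top|$ (no box). Finally $\|\mathrm{ICLval}\ s\| = (\lambda A.\,\mathrm{Mval}\,A)\,\|s\|$. **Theorem (Soundness of the embeddings of $ICL$, $ICL^{\Rightarrow}$ and $ICL^{B}$ in simple type theory).** Let $s$ be a formula of $ICL$ (resp. $ICL^{\Rightarrow}$, $ICL^{B}$). If $\{\mathtt R,\mathtt T\}\models \|\mathrm{ICLval}\ s\|$, then $\vdash s$ in $ICL$ (resp. $ICL^{\Rightarrow}$, $ICL^{B}$). -/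

import Mathlib

universe u

/-! ## Simple type theory -/

/-- Simple types, freely generated from the base types `o` (Booleans) and `ι` (individuals). -/
inductive Ty : Type
  | o : Ty
  | ι : Ty
  | arr : Ty → Ty → Ty
  deriving DecidableEq

namespace Ty

infixr:30 " ⇾ " => Ty.arr

/-- The type of (lifted) modal formulas: sets of worlds. -/
abbrev pred : Ty := ι ⇾ o

/-- The type of accessibility relations. -/
abbrev rel : Ty := ι ⇾ ι ⇾ o

end Ty

/-- Terms of simple type theory over a family `C` of typed constants. For every type there are
countably many variables, named by natural numbers. -/
inductive Tm (C : Ty → Type u) : Ty → Type u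
  | const {α : Ty} (c : C α) : Tm C α
  | var (α : Ty) (n : ℕ) : Tm C α
  | lam (α : Ty) (n : ℕ) {β : Ty} (s : Tm C β) : Tm C (Ty.arr α β)
  | app {α β : Ty} (s : Tm C (Ty.arr α β)) (t : Tm C α) : Tm C β
  | neg (s : Tm C Ty.o) : Tm C Ty.o
  | or (s t : Tm C Ty.o) : Tm C Ty.o
  | pi {α : Ty} (s : Tm C (Ty.arr α Ty.o)) : Tm C Ty.o

namespace Tm

variable {C : Ty → Type u}

infixl:70 " ⬝ " => Tm.app

/-- `∀ X_α. s`, binder notation for `Π (λ X_α. s)`. -/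
def all (α : Ty) (n : ℕ) (s : Tm C Ty.o) : Tm C Ty.o := pi (lam α n s)

/-- `s ⇒ t`, as `¬ s ∨ t`. -/
def imp (s t : Tm C Ty.o) : Tm C Ty.o := or (neg s) t

/-- `s ∧ t`, as `¬ (¬ s ∨ ¬ t)`. -/
def and (s t : Tm C Ty.o) : Tm C Ty.o := neg (or (neg s) (neg t))

/-- `⊤`, as `∀ X_o. X ⇒ X`. -/
def top : Tm C Ty.o := all Ty.o 0 (imp (var Ty.o 0) (var Ty.o 0))

/-- `⊥`, as `¬ ⊤`. -/
def bot : Tm C Ty.o := neg top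

end Tm

/-! ## Henkin semantics -/

/-- A frame: non-empty domains, `D_o` a set of two truth values, and the elements of
`D_{α → β}` being functions from `D_α` to `D_β` (`ev f` is the function that `f` is; `ev` is
injective, so that two elements with the same values are equal). -/
structure Frame : Type (u + 1) where
  D : Ty → Type u
  nonempty : ∀ α, Nonempty (D α)
  truth : D Ty.o ≃ Prop
  ev : ∀ {α β : Ty}, D (Ty.arr α β) → D α → D β
  ev_injective : ∀ {α β : Ty},
    Function.Injective (ev : D (Ty.arr α β) → D α → D β)

namespace Frame

/-- Variable assignments. -/
abbrev Assignment (F : Frame.{u}) : Type u := ∀ α : Ty, ℕ → F.D α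

/-- The assignment `[z/X_α], φ`, with `X` the `n`-th variable of type `α`. -/
def Assignment.set {F : Frame.{u}} (φ : F.Assignment) (α : Ty) (n : ℕ) (z : F.D α) :
    F.Assignment :=
  Function.update φ α (Function.update (φ α) n z)

end Frame

/-- A Henkin (general) model: a frame with denotations of the constants that has a valuation `V`
of all terms. The clauses determine `V` uniquely, by induction on terms. -/
structure HenkinModel (C : Ty → Type u) : Type (u + 1) extends Frame.{u} where
  I : ∀ {α : Ty}, C α → D α
  V : toFrame.Assignment → ∀ {α : Ty}, Tm C α → D α
  V_var : ∀ φ (α : Ty) (n : ℕ), V φ (Tm.var α n) = φ α n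
  V_const : ∀ φ {α : Ty} (c : C α), V φ (Tm.const c) = I c
  V_app : ∀ φ {α β : Ty} (s : Tm C (Ty.arr α β)) (t : Tm C α),
    V φ (Tm.app s t) = ev (V φ s) (V φ t)
  V_lam : ∀ φ (α : Ty) (n : ℕ) {β : Ty} (s : Tm C β) (z : D α),
    ev (V φ (Tm.lam α n s)) z = V (φ.set α n z) s
  V_neg : ∀ φ (s : Tm C Ty.o), truth (V φ (Tm.neg s)) ↔ ¬ truth (V φ s)
  V_or : ∀ φ (s t : Tm C Ty.o),
    truth (V φ (Tm.or s t)) ↔ truth (V φ s) ∨ truth (V φ t)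
  V_pi : ∀ φ {α : Ty} (s : Tm C (Ty.arr α Ty.o)),
    truth (V φ (Tm.pi s)) ↔ ∀ z : D α, truth (ev (V φ s) z)

/-- `A` is valid in `M`: it is true under every assignment. -/
def HenkinModel.Valid {C : Ty → Type u} (M : HenkinModel C) (A : Tm C Ty.o) : Prop :=
  ∀ φ : M.toFrame.Assignment, M.truth (M.V φ A)

/-- `Γ ⊨ A`: `A` is valid in every Henkin model in which all formulas of `Γ` are valid. -/
def HenkinEntails {C : Ty → Type u} (Γ : Set (Tm C Ty.o)) (A : Tm C Ty.o) : Prop :=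
  ∀ M : HenkinModel C, (∀ B ∈ Γ, M.Valid B) → M.Valid A

/-! ## Modal connectives as terms -/

/-- The signature: a constant of type `ι → o` for each atomic proposition and, distinct from
these, for each atomic principal, and one relation constant of type `ι → ι → o`. -/
inductive Sig (P A : Type u) : Ty → Type u
  | prop (p : P) : Sig P A Ty.pred
  | princ (a : A) : Sig P A Ty.pred
  | r : Sig P A Ty.rel

/-- Terms of type `ι → o`, denoting sets of worlds. -/
abbrev WTm (P A : Type u) : Type u := Tm (Sig P A) Ty.pred

namespace Modal

open Tm

variable {P A : Type u}

/-- `|r|` -/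
def r : Tm (Sig P A) Ty.rel := const Sig.r

/-- The variable number `n` of type `ι → o`. -/
abbrev S (n : ℕ) : WTm P A := var Ty.pred n

/-- The variable number `n` of type `ι`. -/
abbrev X (n : ℕ) : Tm (Sig P A) Ty.ι := var Ty.ι n

/-- `λ A. λ B. λ X. A X ∨ B X` -/
def mOr : Tm (Sig P A) (Ty.pred ⇾ Ty.pred ⇾ Ty.pred) :=
  lam _ 0 (lam _ 1 (lam _ 0 (or (S 0 ⬝ X 0) (S 1 ⬝ X 0))))

/-- `λ A. λ B. λ X. A X ∧ B X` -/
def mAnd : Tm (Sig P A) (Ty.pred ⇾ Ty.pred ⇾ Ty.pred) :=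
  lam _ 0 (lam _ 1 (lam _ 0 (and (S 0 ⬝ X 0) (S 1 ⬝ X 0))))

/-- `λ A. λ B. λ X. A X ⇒ B X` -/
def mImp : Tm (Sig P A) (Ty.pred ⇾ Ty.pred ⇾ Ty.pred) :=
  lam _ 0 (lam _ 1 (lam _ 0 (imp (S 0 ⬝ X 0) (S 1 ⬝ X 0))))

/-- `λ X. ⊤` -/
def mTop : WTm P A := lam Ty.ι 0 top

/-- `λ X. ⊥` -/
def mBot : WTm P A := lam Ty.ι 0 bot

/-- `λ R. λ A. λ X. ∀ Y. R X Y ⇒ A Y` -/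
def mBox : Tm (Sig P A) (Ty.rel ⇾ Ty.pred ⇾ Ty.pred) :=
  lam Ty.rel 0 (lam _ 0 (lam _ 0
    (all Ty.ι 1 (imp (var Ty.rel 0 ⬝ X 0 ⬝ X 1) (S 0 ⬝ X 1)))))

/-- `λ A. ∀ W. A W` -/
def mVal : Tm (Sig P A) (Ty.pred ⇾ Ty.o) :=
  lam _ 0 (all Ty.ι 0 (S 0 ⬝ X 0))

/-- The term `∀ X. Mval (□_r X ⊃ X)`. -/
def axR : Tm (Sig P A) Ty.o :=
  all Ty.pred 0 (mVal ⬝ (mImp ⬝ (mBox ⬝ r ⬝ S 0) ⬝ S 0))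

/-- The term `∀ X. Mval (□_r X ⊃ □_r □_r X)`. -/
def axT : Tm (Sig P A) Ty.o :=
  all Ty.pred 0
    (mVal ⬝ (mImp ⬝ (mBox ⬝ r ⬝ S 0) ⬝ (mBox ⬝ r ⬝ (mBox ⬝ r ⬝ S 0))))

end Modal

/-! ## Access control connectives as terms -/

namespace Embed

open Tm Modal

variable {P A : Type u}

/-- `λ S. λ T. |S ∧ T|` -/
def eAnd : Tm (Sig P A) (Ty.pred ⇾ Ty.pred ⇾ Ty.pred) :=
  lam _ 0 (lam _ 1 (mAnd ⬝ S 0 ⬝ S 1))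

/-- `λ S. λ T. |S ∨ T|` -/
def eOr : Tm (Sig P A) (Ty.pred ⇾ Ty.pred ⇾ Ty.pred) :=
  lam _ 0 (lam _ 1 (mOr ⬝ S 0 ⬝ S 1))

/-- `λ S. λ T. |□_r (S ⊃ T)|` -/
def eImp : Tm (Sig P A) (Ty.pred ⇾ Ty.pred ⇾ Ty.pred) :=
  lam _ 0 (lam _ 1 (mBox ⬝ r ⬝ (mImp ⬝ S 0 ⬝ S 1)))

/-- `λ A. λ S. |□_r (A ∨ S)|` -/
def eSays : Tm (Sig P A) (Ty.pred ⇾ Ty.pred ⇾ Ty.pred) :=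
  lam _ 0 (lam _ 1 (mBox ⬝ r ⬝ (mOr ⬝ S 0 ⬝ S 1)))

/-- `λ A. λ B. |□_r (A ⊃ B)|` -/
def eSpeaksFor : Tm (Sig P A) (Ty.pred ⇾ Ty.pred ⇾ Ty.pred) :=
  lam _ 0 (lam _ 1 (mBox ⬝ r ⬝ (mImp ⬝ S 0 ⬝ S 1)))

/-- The term `|□_r p|` for an atomic proposition `p`. -/
def eAtom (p : P) : WTm P A := mBox ⬝ r ⬝ const (Sig.prop p)

/-- The constant for an atomic principal. -/
def ePrinc (a : A) : WTm P A := const (Sig.princ a)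

/-- `λ A. Mval A` -/
def eVal : Tm (Sig P A) (Ty.pred ⇾ Ty.o) := lam _ 0 (mVal ⬝ S 0)

end Embed

/-! ## The logics `ICL` and `ICL^B` -/

/-- Formulas over atomic propositions `P` and principals `Q`; `say B s` is `B says s`. -/
inductive Form (P Q : Type u) : Type u
  | atom (p : P) : Form P Q
  | and (s t : Form P Q) : Form P Q
  | or (s t : Form P Q) : Form P Q
  | imp (s t : Form P Q) : Form P Q
  | bot : Form P Q
  | top : Form P Q
  | say (B : Q) (s : Form P Q) : Form P Q

/-- Axiom schemes of `ICL`: a complete list for intuitionistic propositional logic (with modus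
ponens as the rule), and `unit`, `cuc`, `idem`. -/
inductive Form.Axiom0 {P Q : Type u} : Form P Q → Prop
  | k (s t) : Axiom0 (imp s (imp t s))
  | s (s t w) : Axiom0 (imp (imp s (imp t w)) (imp (imp s t) (imp s w)))
  | andIntro (s t) : Axiom0 (imp s (imp t (and s t)))
  | andLeft (s t) : Axiom0 (imp (and s t) s)
  | andRight (s t) : Axiom0 (imp (and s t) t)
  | orLeft (s t) : Axiom0 (imp s (or s t))
  | orRight (s t) : Axiom0 (imp t (or s t))
  | orElim (s t w) : Axiom0 (imp (imp s w) (imp (imp t w) (imp (or s t) w)))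
  | botElim (s) : Axiom0 (imp bot s)
  | topIntro : Axiom0 top
  | unit (B s) : Axiom0 (imp s (say B s))
  | cuc (B s t) : Axiom0 (imp (say B (imp s t)) (imp (say B s) (say B t)))
  | idem (B s) : Axiom0 (imp (say B (say B s)) (say B s))

/-- The term `‖s‖`, given the terms for the principals. -/
def Form.embed {P A Q : Type u} (pr : Q → WTm P A) : Form P Q → WTm P A
  | .atom p => Embed.eAtom p
  | .and s t => Embed.eAnd ⬝ s.embed pr ⬝ t.embed pr
  | .or s t => Embed.eOr ⬝ s.embed pr ⬝ t.embed pr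
  | .imp s t => Embed.eImp ⬝ s.embed pr ⬝ t.embed pr
  | .bot => Modal.mBot
  | .top => Modal.mTop
  | .say B s => Embed.eSays ⬝ pr B ⬝ s.embed pr

/-- Formulas of `ICL`: the principals are atomic. -/
abbrev ICL (P A : Type u) : Type u := Form P A

/-- Provability in `ICL`. -/
inductive ICL.Provable {P A : Type u} : ICL P A → Prop
  | ax {s} (h : Form.Axiom0 s) : Provable s
  | mp {s t} (h₁ : Provable (Form.imp s t)) (h₂ : Provable s) : Provable t

/-- The term `‖ICLval s‖` for `s` in `ICL`. -/
def ICL.val {P A : Type u} (s : ICL P A) : Tm (Sig P A) Ty.o :=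
  Embed.eVal ⬝ Form.embed Embed.ePrinc s

/-- Principals of `ICL^B`: Boolean expressions over atomic principals. -/
inductive Prin (A : Type u) : Type u
  | atom (a : A) : Prin A
  | and (B C : Prin A) : Prin A
  | or (B C : Prin A) : Prin A
  | imp (B C : Prin A) : Prin A
  | bot : Prin A
  | top : Prin A

namespace Prin

variable {P A : Type u}

/-- The truth value of a Boolean expression. -/
def eval (v : A → Prop) : Prin A → Prop
  | atom a => v a
  | and B C => B.eval v ∧ C.eval v
  | or B C => B.eval v ∨ C.eval v
  | imp B C => B.eval v → C.eval v
  | bot => False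
  | top => True

/-- `B ≡ C`: equality of Boolean expressions in classical propositional logic. -/
def Equivalent (B C : Prin A) : Prop := ∀ v : A → Prop, B.eval v ↔ C.eval v

/-- Boolean principals are mapped to the corresponding Boolean modal expressions (no box). -/
def embed : Prin A → WTm P A
  | atom a => Embed.ePrinc a
  | and B C => Modal.mAnd ⬝ B.embed ⬝ C.embed
  | or B C => Modal.mOr ⬝ B.embed ⬝ C.embed
  | imp B C => Modal.mImp ⬝ B.embed ⬝ C.embed
  | bot => Modal.mBot
  | top => Modal.mTop

end Prin

/-- Formulas of `ICL^B`: the principals are Boolean expressions. -/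
abbrev ICLB (P A : Type u) : Type u := Form P (Prin A)

/-- Provability in `ICL^B`. -/
inductive ICLB.Provable {P A : Type u} : ICLB P A → Prop
  | ax {s} (h : Form.Axiom0 s) : Provable s
  | trust (s) : Provable (Form.imp (Form.say Prin.bot s) s)
  | untrust (B : Prin A) (h : Prin.Equivalent B Prin.top) : Provable (Form.say B Form.bot)
  | cuc' (B C : Prin A) (s) : Provable
      (Form.imp (Form.say (Prin.imp B C) s) (Form.imp (Form.say B s) (Form.say C s)))
  | mp {s t} (h₁ : Provable (Form.imp s t)) (h₂ : Provable s) : Provable t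

/-- The term `‖ICLval s‖` for `s` in `ICL^B`. -/
def ICLB.val {P A : Type u} (s : ICLB P A) : Tm (Sig P A) Ty.o :=
  Embed.eVal ⬝ Form.embed Prin.embed s

/-! ## The logic `ICL^⇒` -/

/-- Formulas of `ICL^⇒`: those of `ICL`, and `A ⟹ B` for (atomic) principals. -/
inductive ICLSF (P A : Type u) : Type u
  | atom (p : P) : ICLSF P A
  | and (s t : ICLSF P A) : ICLSF P A
  | or (s t : ICLSF P A) : ICLSF P A
  | imp (s t : ICLSF P A) : ICLSF P A
  | bot : ICLSF P A
  | top : ICLSF P A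
  | say (B : A) (s : ICLSF P A) : ICLSF P A
  | speaksFor (B C : A) : ICLSF P A

namespace ICLSF

variable {P A : Type u}

/-- Provability in `ICL^⇒`. -/
inductive Provable : ICLSF P A → Prop
  | k (s t) : Provable (imp s (imp t s))
  | s (s t w) : Provable (imp (imp s (imp t w)) (imp (imp s t) (imp s w)))
  | andIntro (s t) : Provable (imp s (imp t (and s t)))
  | andLeft (s t) : Provable (imp (and s t) s)
  | andRight (s t) : Provable (imp (and s t) t)
  | orLeft (s t) : Provable (imp s (or s t))
  | orRight (s t) : Provable (imp t (or s t))
  | orElim (s t w) : Provable (imp (imp s w) (imp (imp t w) (imp (or s t) w)))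
  | botElim (s) : Provable (imp bot s)
  | topIntro : Provable top
  | unit (B s) : Provable (imp s (say B s))
  | cuc (B s t) : Provable (imp (say B (imp s t)) (imp (say B s) (say B t)))
  | idem (B s) : Provable (imp (say B (say B s)) (say B s))
  | refl (B) : Provable (speaksFor B B)
  | trans (B C D) :
      Provable (imp (speaksFor B C) (imp (speaksFor C D) (speaksFor B D)))
  | speakingFor (B C s) :
      Provable (imp (speaksFor B C) (imp (say B s) (say C s)))
  | handoff (B C) : Provable (imp (say C (speaksFor B C)) (speaksFor B C))
  | mp {s t} (h₁ : Provable (imp s t)) (h₂ : Provable s) : Provable t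

/-- The term `‖s‖`. -/
def embed : ICLSF P A → WTm P A
  | atom p => Embed.eAtom p
  | and s t => Embed.eAnd ⬝ s.embed ⬝ t.embed
  | or s t => Embed.eOr ⬝ s.embed ⬝ t.embed
  | imp s t => Embed.eImp ⬝ s.embed ⬝ t.embed
  | bot => Modal.mBot
  | top => Modal.mTop
  | say B s => Embed.eSays ⬝ Embed.ePrinc B ⬝ s.embed
  | speaksFor B C => Embed.eSpeaksFor ⬝ Embed.ePrinc B ⬝ Embed.ePrinc C

/-- The term `‖ICLval s‖` for `s` in `ICL^⇒`. -/
def val (s : ICLSF P A) : Tm (Sig P A) Ty.o := Embed.eVal ⬝ s.embed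

end ICLSF

/-! The proof is by contraposition, through canonical Kripke models. The full type hierarchy over a
preorder, with arbitrary sets of worlds for the propositions and principals, is a Henkin model of
`R` and `T`. An entailed formula therefore holds at every world of every such preorder
(`holds_of_entails`). It remains to find, for each logic, a preorder where only theorems hold
everywhere.

Worlds carry prime theories, ordered by inclusion. Implication is treated as in intuitionistic
logic. Since `B says s` becomes a boxed disjunction, membership of `B says s` in a theory must mean
that every larger world makes `B` true or contains `s`. So `B` may be false only at theories that
contain `t` whenever they contain `B says t`, and if `B says s` is missing, some larger world must
make `B` false and omit `s`. `Canonical` collects these demands, and they suffice for the truth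
lemma.

For `ICL`, a prime theory maximal among those omitting `B says s` is closed under `B`, by `unit`,
`cuc` and `idem`. For `ICL^⇒`, the valuation falsifies exactly the principals that speak for `B`,
and `handoff` supplies the counterexamples to a missing `B ⇒ C`. For `ICL^B`, the principals `C`
with `C says s` in the theory form a Boolean filter. The prime ideal theorem gives a valuation that
falsifies `B` and verifies this filter, and the theory is then enlarged until it is closed under all
falsified principals at once. -/

/-! ## Standard models over a Kripke frame -/

namespace Standard

/-- The full type hierarchy over a set `W` of individuals. -/
def Dom (W : Type u) : Ty → Type u
  | Ty.o => ULift.{u} Prop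
  | Ty.ι => W
  | Ty.arr α β => Dom W α → Dom W β

instance instNonemptyDom (W : Type u) [Nonempty W] : ∀ α, Nonempty (Dom W α)
  | Ty.o => ⟨ULift.up True⟩
  | Ty.ι => ‹Nonempty W›
  | Ty.arr α β => by
    obtain ⟨b⟩ := instNonemptyDom W β
    exact ⟨fun _ : Dom W α => b⟩

/-- The full frame over `W`. -/
abbrev frame (W : Type u) [Nonempty W] : Frame.{u} where
  D := Dom W
  nonempty := instNonemptyDom W
  truth := Equiv.ulift
  ev := fun f => f
  ev_injective := fun {_ _} _ _ h => h

/-- The value of a term in the full frame over `W`. -/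
def value {C : Ty → Type u} (W : Type u) [Nonempty W] (I : ∀ {α : Ty}, C α → Dom W α) :
    (frame W).Assignment → ∀ {α : Ty}, Tm C α → Dom W α
  | _, _, .const c => I c
  | φ, _, .var α n => φ α n
  | φ, _, .lam α n s => fun z : Dom W α => value W I (φ.set α n z) s
  | φ, _, .app s t => (value W I φ s) (value W I φ t)
  | φ, _, .neg s => ULift.up (¬ (value W I φ s).down)
  | φ, _, .or s t => ULift.up ((value W I φ s).down ∨ (value W I φ t).down)
  | φ, _, .pi s => ULift.up (∀ z, ((value W I φ s) z).down)

/-- The standard Henkin model over `W` with denotations `I` of the constants. -/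
def model {C : Ty → Type u} (W : Type u) [Nonempty W] (I : ∀ {α : Ty}, C α → Dom W α) :
    HenkinModel C where
  toFrame := frame W
  I := I
  V := value W I
  V_var _ _ _ := rfl
  V_const _ _ _ := rfl
  V_app _ _ _ _ _ := rfl
  V_lam _ _ _ _ _ _ := rfl
  V_neg _ _ := Iff.rfl
  V_or _ _ _ := Iff.rfl
  V_pi _ _ _ := Iff.rfl

section Kripke

variable {P A W : Type u} [Nonempty W]

/-- Denotations of the signature given by a Kripke frame with valuations. -/
def interp (R : W → W → Prop) (π : P → W → Prop) (ρ : A → W → Prop) :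
    ∀ {α : Ty}, Sig P A α → Dom W α
  | _, .prop p => fun w : W => ULift.up (π p w)
  | _, .princ a => fun w : W => ULift.up (ρ a w)
  | _, .r => fun w v : W => ULift.up (R w v)

variable (R : W → W → Prop) (π : P → W → Prop) (ρ : A → W → Prop)

/-- The world `w` belongs to the set denoted by the term `s`. -/
def Holds (φ : (frame W).Assignment) (w : W) (s : WTm P A) : Prop :=
  ULift.down (value W (interp R π ρ) φ s w)

variable {R π ρ} {φ : (frame W).Assignment} {w : W} {s t : WTm P A}

/-! ### Values of embedded terms as Kripke satisfaction. -/

theorem set_apply_self (φ : (frame W).Assignment) (α : Ty) (n : ℕ) (z : Dom W α) :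
    (φ.set α n z : (frame W).Assignment) α n = z := by
  simp [Frame.Assignment.set]

theorem set_apply_of_ne (φ : (frame W).Assignment) (α : Ty) {n m : ℕ} (h : m ≠ n)
    (z : Dom W α) : (φ.set α n z : (frame W).Assignment) α m = φ α m := by
  simp [Frame.Assignment.set, h]

theorem set_apply_of_type_ne (φ : (frame W).Assignment) {α β : Ty} (h : β ≠ α) (n m : ℕ)
    (z : Dom W α) : (φ.set α n z : (frame W).Assignment) β m = φ β m := by
  simp [Frame.Assignment.set, h]

theorem holds_princ {a : A} : Holds R π ρ φ w (Embed.ePrinc a) ↔ ρ a w := Iff.rfl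

theorem holds_mTop : Holds R π ρ φ w Modal.mTop := by
  simp [Holds, Modal.mTop, Tm.top, Tm.all, Tm.imp, value, em']

theorem not_holds_mBot : ¬ Holds R π ρ φ w Modal.mBot := by
  simp [Holds, Modal.mBot, Tm.bot, Tm.top, Tm.all, Tm.imp, value, em']

theorem holds_mOr :
    Holds R π ρ φ w (Modal.mOr ⬝ s ⬝ t) ↔ Holds R π ρ φ w s ∨ Holds R π ρ φ w t := by
  simp [Holds, Modal.mOr, value, Frame.Assignment.set]
  rfl

theorem holds_mAnd :
    Holds R π ρ φ w (Modal.mAnd ⬝ s ⬝ t) ↔ Holds R π ρ φ w s ∧ Holds R π ρ φ w t := by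
  simp [Holds, Modal.mAnd, Tm.and, value, Frame.Assignment.set]
  rfl

theorem holds_mImp :
    Holds R π ρ φ w (Modal.mImp ⬝ s ⬝ t) ↔ (Holds R π ρ φ w s → Holds R π ρ φ w t) := by
  simp [Holds, Modal.mImp, Tm.imp, value, Frame.Assignment.set,
    imp_iff_not_or]
  rfl

theorem holds_mBox :
    Holds R π ρ φ w (Modal.mBox ⬝ Modal.r ⬝ s) ↔ ∀ v, R w v → Holds R π ρ φ v s := by
  simp [Holds, Modal.mBox, Modal.r, Tm.all, Tm.imp, value, set_apply_self, set_apply_of_ne,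
    set_apply_of_type_ne, imp_iff_not_or, interp]
  rfl

/-- Semantic β-reduction. It leaves the body intact, so that the clauses for the modal connectives
apply to it with variables as arguments. -/
theorem holds_lam₂ {b : WTm P A} : Holds R π ρ φ w (Tm.lam Ty.pred 0 (Tm.lam Ty.pred 1 b) ⬝ s ⬝ t) ↔
    Holds R π ρ ((φ.set Ty.pred 0 (value W (interp R π ρ) φ s)).set Ty.pred 1
      (value W (interp R π ρ) φ t)) w b := Iff.rfl

theorem holds_var_zero {f g : Dom W Ty.pred} : Holds (P := P) (A := A) R π ρ
    ((φ.set Ty.pred 0 f).set Ty.pred 1 g) w (Modal.S 0) ↔ (f w).down := by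
  simp [Holds, value, set_apply_self, set_apply_of_ne]

theorem holds_var_one {f g : Dom W Ty.pred} : Holds (P := P) (A := A) R π ρ
    ((φ.set Ty.pred 0 f).set Ty.pred 1 g) w (Modal.S 1) ↔ (g w).down := by
  simp [Holds, value, set_apply_self]

theorem holds_eAnd :
    Holds R π ρ φ w (Embed.eAnd ⬝ s ⬝ t) ↔ Holds R π ρ φ w s ∧ Holds R π ρ φ w t := by
  simp only [Embed.eAnd, holds_lam₂, holds_mAnd, holds_var_zero, holds_var_one]; rfl

theorem holds_eOr :
    Holds R π ρ φ w (Embed.eOr ⬝ s ⬝ t) ↔ Holds R π ρ φ w s ∨ Holds R π ρ φ w t := by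
  simp only [Embed.eOr, holds_lam₂, holds_mOr, holds_var_zero, holds_var_one]; rfl

theorem holds_eImp : Holds R π ρ φ w (Embed.eImp ⬝ s ⬝ t) ↔
    ∀ v, R w v → Holds R π ρ φ v s → Holds R π ρ φ v t := by
  simp only [Embed.eImp, holds_lam₂, holds_mBox, holds_mImp, holds_var_zero, holds_var_one]; rfl

theorem holds_eSpeaksFor : Holds R π ρ φ w (Embed.eSpeaksFor ⬝ s ⬝ t) ↔
    ∀ v, R w v → Holds R π ρ φ v s → Holds R π ρ φ v t :=
  holds_eImp

theorem holds_eSays : Holds R π ρ φ w (Embed.eSays ⬝ s ⬝ t) ↔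
    ∀ v, R w v → Holds R π ρ φ v s ∨ Holds R π ρ φ v t := by
  simp only [Embed.eSays, holds_lam₂, holds_mBox, holds_mOr, holds_var_zero, holds_var_one]; rfl

theorem holds_eAtom {p : P} : Holds R π ρ φ w (Embed.eAtom p) ↔ ∀ v, R w v → π p v :=
  holds_mBox

theorem holds_prin {B : Prin A} :
    Holds R π ρ φ w B.embed ↔ B.eval (fun a => ρ a w) := by
  induction B with
  | atom a => exact holds_princ
  | and B C hB hC => exact holds_mAnd.trans (and_congr hB hC)
  | or B C hB hC => exact holds_mOr.trans (or_congr hB hC)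
  | imp B C hB hC => exact holds_mImp.trans (imp_congr hB hC)
  | bot => exact iff_of_false not_holds_mBot id
  | top => exact iff_of_true holds_mTop trivial

theorem value_mVal :
    (value W (interp R π ρ) φ (Modal.mVal ⬝ s)).down ↔ ∀ w, Holds R π ρ φ w s := by
  simp [Holds, Modal.mVal, Tm.all, value, set_apply_self, set_apply_of_type_ne]
  rfl

theorem value_eVal :
    (value W (interp R π ρ) φ (Embed.eVal ⬝ s)).down ↔ ∀ w, Holds R π ρ φ w s := by
  refine (value_mVal (s := Modal.S 0)
    (φ := φ.set Ty.pred 0 (value W (interp R π ρ) φ s))).trans (forall_congr' fun w => ?_)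
  simp [Holds, value, set_apply_self]

theorem valid_axR (hR : ∀ w, R w w) :
    (model W (interp R π ρ)).Valid (Modal.axR : Tm (Sig P A) Ty.o) := by
  refine fun φ z => value_mVal.2 fun w => holds_mImp.2 fun h => holds_mBox.1 h w (hR w)

theorem valid_axT (hR : ∀ w v x, R w v → R v x → R w x) :
    (model W (interp R π ρ)).Valid (Modal.axT : Tm (Sig P A) Ty.o) := by
  refine fun φ z => value_mVal.2 fun w => holds_mImp.2 fun h => holds_mBox.2 fun v hv =>
    holds_mBox.2 fun x hx => holds_mBox.1 h x (hR w v x hv hx)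

/-- A consequence of `R` and `T` of the form `ICLval s` holds at every world of a preorder. -/
theorem holds_of_entails (hr : ∀ w, R w w) (ht : ∀ w v x, R w v → R v x → R w x)
    (h : HenkinEntails {Modal.axR, Modal.axT} (Embed.eVal ⬝ s)) (w : W) :
    ∃ φ, Holds R π ρ φ w s := by
  have hM := h (model W (interp R π ρ)) (by
    rintro B (rfl | rfl)
    · exact valid_axR hr
    · exact valid_axT ht)
  -- Validity covers all assignments, so any one will do.
  have φ : (frame W).Assignment := fun α _ => Classical.choice (instNonemptyDom W α)
  exact ⟨φ, value_eVal.1 (hM φ) w⟩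

end Kripke

end Standard

/-! ## Prime theories of access control logics -/

/-- A logic over the formulas `Φ` and the principals `Q` that satisfies the axioms of `ICL`. -/
structure AccessLogic (Q Φ : Type u) where
  imp : Φ → Φ → Φ
  and : Φ → Φ → Φ
  or : Φ → Φ → Φ
  bot : Φ
  top : Φ
  say : Q → Φ → Φ
  Pr : Φ → Prop
  mp : ∀ {s t}, Pr (imp s t) → Pr s → Pr t
  k : ∀ s t, Pr (imp s (imp t s))
  s : ∀ s t w, Pr (imp (imp s (imp t w)) (imp (imp s t) (imp s w)))
  andIntro : ∀ s t, Pr (imp s (imp t (and s t)))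
  andLeft : ∀ s t, Pr (imp (and s t) s)
  andRight : ∀ s t, Pr (imp (and s t) t)
  orLeft : ∀ s t, Pr (imp s (or s t))
  orRight : ∀ s t, Pr (imp t (or s t))
  orElim : ∀ s t w, Pr (imp (imp s w) (imp (imp t w) (imp (or s t) w)))
  botElim : ∀ s, Pr (imp bot s)
  topIntro : Pr top
  unit : ∀ B s, Pr (imp s (say B s))
  cuc : ∀ B s t, Pr (imp (say B (imp s t)) (imp (say B s) (say B t)))
  idem : ∀ B s, Pr (imp (say B (say B s)) (say B s))

namespace AccessLogic

variable {Q Φ : Type u} (L : AccessLogic Q Φ)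

/-- A set of formulas that contains the theorems and is closed under modus ponens. -/
structure IsTheory (T : Set Φ) : Prop where
  thm : ∀ {s}, L.Pr s → s ∈ T
  mp : ∀ {s t}, L.imp s t ∈ T → s ∈ T → t ∈ T

/-- A consistent theory with the disjunction property. -/
structure IsPrime (T : Set Φ) : Prop extends L.IsTheory T where
  bot_notMem : L.bot ∉ T
  prime : ∀ {s t}, L.or s t ∈ T → s ∈ T ∨ t ∈ T

/-- `T` contains `s` whenever it contains `B says s`. -/
def IsClosed (B : Q) (T : Set Φ) : Prop := ∀ t, L.say B t ∈ T → t ∈ T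

variable {L} {T : Set Φ} {s t w : Φ} {B : Q}

theorem isTheory_setOf_pr : L.IsTheory {s | L.Pr s} := ⟨id, L.mp⟩

/-! ### Theories and their prime extensions. -/

namespace IsTheory

theorem app (hT : L.IsTheory T) (h : L.Pr (L.imp s t)) (hs : s ∈ T) : t ∈ T :=
  hT.mp (hT.thm h) hs

theorem app₂ (hT : L.IsTheory T) (h : L.Pr (L.imp s (L.imp t w))) (hs : s ∈ T) (ht : t ∈ T) :
    w ∈ T :=
  hT.mp (hT.app h hs) ht

theorem imp_self (hT : L.IsTheory T) (s : Φ) : L.imp s s ∈ T :=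
  hT.app₂ (L.s s (L.imp s s) s) (hT.thm (L.k _ _)) (hT.thm (L.k _ _))

theorem imp_trans (hT : L.IsTheory T) (h₁ : L.imp s t ∈ T) (h₂ : L.imp t w ∈ T) :
    L.imp s w ∈ T :=
  hT.app₂ (L.s s t w) (hT.app (L.k _ _) h₂) h₁

/-- The theory generated by `T` and `s`. -/
theorem insert (hT : L.IsTheory T) (s : Φ) : L.IsTheory {t | L.imp s t ∈ T} where
  thm h := hT.app (L.k _ _) (hT.thm h)
  mp h₁ h₂ := hT.app₂ (L.s _ _ _) h₁ h₂

theorem subset_insert (hT : L.IsTheory T) (s : Φ) : T ⊆ {t | L.imp s t ∈ T} :=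
  fun _ h => hT.app (L.k _ _) h

theorem say_mono (hT : L.IsTheory T) (h : L.imp s t ∈ T) : L.imp (L.say B s) (L.say B t) ∈ T :=
  hT.app (L.cuc B s t) (hT.app (L.unit B _) h)

theorem and_mem_iff (hT : L.IsTheory T) : L.and s t ∈ T ↔ s ∈ T ∧ t ∈ T :=
  ⟨fun h => ⟨hT.app (L.andLeft _ _) h, hT.app (L.andRight _ _) h⟩,
    fun h => hT.app₂ (L.andIntro _ _) h.1 h.2⟩

/-- A theory that avoids an upward directed set `U` extends to a prime theory that is maximal
among those avoiding `U`. -/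
theorem exists_prime (hT : L.IsTheory T) {U : Set Φ} (hne : U.Nonempty)
    (hdir : ∀ s ∈ U, ∀ t ∈ U, ∃ w ∈ U, L.Pr (L.imp s w) ∧ L.Pr (L.imp t w))
    (hU : ∀ s ∈ U, s ∉ T) :
    ∃ T', T ⊆ T' ∧ L.IsPrime T' ∧ (∀ s ∈ U, s ∉ T') ∧ ∀ t ∉ T', ∃ s ∈ U, L.imp t s ∈ T' := by
  obtain ⟨M, hTM, hM⟩ := zorn_subset_nonempty {T' | L.IsTheory T' ∧ ∀ s ∈ U, s ∉ T'}
    (by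
      intro c hc hchain hcne
      refine ⟨⋃₀ c, ⟨⟨fun h => ?_, ?_⟩, ?_⟩, fun X hX => Set.subset_sUnion_of_mem hX⟩
      · obtain ⟨X, hX⟩ := hcne
        exact ⟨X, hX, (hc hX).1.thm h⟩
      · rintro s t ⟨X, hX, hs⟩ ⟨Y, hY, ht⟩
        rcases hchain.total hX hY with h | h
        · exact ⟨Y, hY, (hc hY).1.mp (h hs) ht⟩
        · exact ⟨X, hX, (hc hX).1.mp hs (h ht)⟩
      · rintro s hs ⟨X, hX, h⟩
        exact (hc hX).2 s hs h) T ⟨hT, hU⟩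
  obtain ⟨hMt, hMU⟩ := hM.prop
  -- Otherwise the theory generated by `M` and `t` would still avoid `U`, against maximality.
  have hmax : ∀ t ∉ M, ∃ s ∈ U, L.imp t s ∈ M := by
    intro t ht
    by_contra! hcon
    exact ht (hM.le_of_ge ⟨hMt.insert t, hcon⟩ (hMt.subset_insert t) (hMt.imp_self t))
  refine ⟨M, hTM, ⟨hMt, fun hb => ?_, fun {s t} hst => ?_⟩, hMU, hmax⟩
  · obtain ⟨u, hu⟩ := hne
    exact hMU u hu (hMt.app (L.botElim u) hb)
  -- If both disjuncts are missing, each implies a member of `U`. By directedness the disjunction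
  -- then implies a common `w` in `U`.
  · by_contra! hcon
    obtain ⟨u, hu, hsu⟩ := hmax s hcon.1
    obtain ⟨v, hv, htv⟩ := hmax t hcon.2
    obtain ⟨w, hw, huw, hvw⟩ := hdir u hu v hv
    exact hMU w hw (hMt.mp (hMt.app₂ (L.orElim s t w) (hMt.imp_trans hsu (hMt.thm huw))
      (hMt.imp_trans htv (hMt.thm hvw))) hst)

theorem exists_prime_of_notMem (hT : L.IsTheory T) (h : s ∉ T) :
    ∃ T', T ⊆ T' ∧ L.IsPrime T' ∧ s ∉ T' ∧ ∀ t ∉ T', L.imp t s ∈ T' := by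
  obtain ⟨T', h₁, h₂, h₃, h₄⟩ := hT.exists_prime (U := {s}) ⟨s, rfl⟩
    (by
      rintro _ rfl _ rfl
      exact ⟨_, rfl, isTheory_setOf_pr.imp_self _, isTheory_setOf_pr.imp_self _⟩)
    (by rintro _ rfl; exact h)
  exact ⟨T', h₁, h₂, h₃ s rfl, fun t ht => by simpa using h₄ t ht⟩

/-- Maximality is used for `B says s`, not for `s`. If `B says t` is present and `t` is missing,
then `t` implies `B says s`, so `B says B says s` is present and `idem` gives a contradiction. By
`unit`, `s` is omitted too. -/
theorem exists_prime_isClosed (hT : L.IsTheory T) (h : L.say B s ∉ T) :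
    ∃ T', T ⊆ T' ∧ L.IsPrime T' ∧ L.IsClosed B T' ∧ s ∉ T' := by
  obtain ⟨T', h₁, h₂, h₃, h₄⟩ := hT.exists_prime_of_notMem h
  refine ⟨T', h₁, h₂, fun t ht => ?_, fun hs => h₃ (h₂.app (L.unit B s) hs)⟩
  by_contra hcon
  exact h₃ (h₂.app (L.idem B s) (h₂.mp (h₂.say_mono (h₄ t hcon)) ht))

end IsTheory

theorem IsPrime.or_mem_iff (hT : L.IsPrime T) : L.or s t ∈ T ↔ s ∈ T ∨ t ∈ T :=
  ⟨hT.prime, fun h => h.elim (hT.app (L.orLeft _ _)) (hT.app (L.orRight _ _))⟩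

variable (L)

/-- A set of worlds labelled by prime theories and valuations of the principals, rich enough for
the truth lemma. -/
structure Canonical (W : Type u) where
  th : W → Set Φ
  val : Q → W → Prop
  isPrime : ∀ w, L.IsPrime (th w)
  isClosed : ∀ {B w}, ¬ val B w → L.IsClosed B (th w)
  exists_of_notMem : ∀ {T s}, L.IsTheory T → s ∉ T → ∃ w, T ⊆ th w ∧ s ∉ th w
  exists_of_say_notMem : ∀ {T B s}, L.IsTheory T → L.say B s ∉ T →
    ∃ w, T ⊆ th w ∧ ¬ val B w ∧ s ∉ th w

/-! ### Membership conditions that drive the truth lemma. -/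

namespace Canonical

variable {L} {W : Type u} (K : L.Canonical W) {w : W}

theorem imp_mem_iff :
    L.imp s t ∈ K.th w ↔ ∀ v, K.th w ⊆ K.th v → s ∈ K.th v → t ∈ K.th v := by
  refine ⟨fun h v hv => (K.isPrime v).mp (hv h), fun h => ?_⟩
  by_contra hcon
  have hw := (K.isPrime w).toIsTheory
  obtain ⟨v, hv, hvt⟩ := K.exists_of_notMem (hw.insert s) hcon
  exact hvt (h v ((hw.subset_insert s).trans hv) (hv (hw.imp_self s)))

theorem say_mem_iff :
    L.say B s ∈ K.th w ↔ ∀ v, K.th w ⊆ K.th v → K.val B v ∨ s ∈ K.th v := by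
  refine ⟨fun h v hv => ?_, fun h => ?_⟩
  · by_contra! hcon
    exact hcon.2 (K.isClosed hcon.1 s (hv h))
  · by_contra hcon
    obtain ⟨v, hv, hB, hs⟩ := K.exists_of_say_notMem (K.isPrime w).toIsTheory hcon
    exact (h v hv).elim hB hs

theorem pr_of_forall_mem (h : ∀ w, s ∈ K.th w) : L.Pr s := by
  by_contra hcon
  obtain ⟨w, -, hw⟩ := K.exists_of_notMem isTheory_setOf_pr hcon
  exact hw (h w)

/-- This is the atomic case of the truth lemma, because atoms are embedded with a box. -/
theorem forall_mem_iff : s ∈ K.th w ↔ ∀ v, K.th w ⊆ K.th v → s ∈ K.th v :=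
  ⟨fun h _ hv => hv h, fun h => h w subset_rfl⟩

open Standard in
/-- If `emb` maps formulas to terms that denote the sets of worlds at which they are members,
then formulas with valid embedding are provable. -/
theorem pr_of_entails {P A : Type u} {emb : Φ → WTm P A} (π : P → W → Prop) (ρ : A → W → Prop)
    (truth : ∀ [Nonempty W] (φ : (frame W).Assignment) (w : W),
      Holds (fun w v => K.th w ⊆ K.th v) π ρ φ w (emb s) → s ∈ K.th w)
    (h : HenkinEntails {Modal.axR, Modal.axT} (Embed.eVal ⬝ emb s)) : L.Pr s := by
  refine K.pr_of_forall_mem fun w => ?_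
  have : Nonempty W := ⟨w⟩
  obtain ⟨φ, hφ⟩ := holds_of_entails (R := fun w v => K.th w ⊆ K.th v) (π := π) (ρ := ρ)
    (fun _ => subset_rfl) (fun _ _ _ => Set.Subset.trans) h w
  exact truth φ w hφ

end Canonical

end AccessLogic

/-! ## Completeness of `ICL` and `ICL^B` -/

section FormLogic

variable {P Q : Type u}

/-- The logic of a set of formulas that contains the axioms of `ICL` and is closed under modus
ponens. -/
def Form.logic (Pr : Form P Q → Prop) (ax : ∀ {s}, Form.Axiom0 s → Pr s)
    (mp : ∀ {s t}, Pr (Form.imp s t) → Pr s → Pr t) : AccessLogic Q (Form P Q) where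
  imp := .imp
  and := .and
  or := .or
  bot := .bot
  top := .top
  say := .say
  Pr := Pr
  mp := mp
  k s t := ax (.k s t)
  s s t w := ax (.s s t w)
  andIntro s t := ax (.andIntro s t)
  andLeft s t := ax (.andLeft s t)
  andRight s t := ax (.andRight s t)
  orLeft s t := ax (.orLeft s t)
  orRight s t := ax (.orRight s t)
  orElim s t w := ax (.orElim s t w)
  botElim s := ax (.botElim s)
  topIntro := ax .topIntro
  unit B s := ax (.unit B s)
  cuc B s t := ax (.cuc B s t)
  idem B s := ax (.idem B s)

open Standard AccessLogic in
-- The truth lemma. Leaving the translation of principals abstract lets it serve both atomic and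
-- Boolean principals.
theorem Form.holds_embed_iff {A W : Type u} [Nonempty W] {Pr : Form P Q → Prop}
    {ax : ∀ {s}, Form.Axiom0 s → Pr s} {mp : ∀ {s t}, Pr (Form.imp s t) → Pr s → Pr t}
    (K : (Form.logic Pr ax mp).Canonical W) {pr : Q → WTm P A} {ρ : A → W → Prop}
    {φ : (frame W).Assignment}
    (hpr : ∀ B w, Holds (fun w v => K.th w ⊆ K.th v) (fun p w => Form.atom p ∈ K.th w) ρ φ w
      (pr B) ↔ K.val B w) (s : Form P Q) (w : W) :
    Holds (fun w v => K.th w ⊆ K.th v) (fun p w => Form.atom p ∈ K.th w) ρ φ w (s.embed pr) ↔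
      s ∈ K.th w := by
  induction s generalizing w with
  | atom p => exact holds_eAtom.trans K.forall_mem_iff.symm
  | and s t hs ht =>
    exact holds_eAnd.trans ((and_congr (hs w) (ht w)).trans (K.isPrime w).and_mem_iff.symm)
  | or s t hs ht =>
    exact holds_eOr.trans ((or_congr (hs w) (ht w)).trans (K.isPrime w).or_mem_iff.symm)
  | imp s t hs ht =>
    exact holds_eImp.trans ((forall₂_congr fun v _ => imp_congr (hs v) (ht v)).trans
      K.imp_mem_iff.symm)
  | bot => exact iff_of_false not_holds_mBot (K.isPrime w).bot_notMem
  | top => exact iff_of_true holds_mTop ((K.isPrime w).thm (ax .topIntro))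
  | say B s hs =>
    exact holds_eSays.trans ((forall₂_congr fun v _ => or_congr (hpr B v) (hs v)).trans
      K.say_mem_iff.symm)

end FormLogic

namespace ICL

variable {P A : Type u}

/-- `ICL` as an access control logic. -/
abbrev logic (P A : Type u) : AccessLogic A (Form P A) :=
  Form.logic (fun s : Form P A => ICL.Provable s) .ax .mp

/-- The prime theories of `ICL`; a principal is false where the theory is closed under it. -/
def canonical (P A : Type u) : (logic P A).Canonical {T : Set (Form P A) // (logic P A).IsPrime T}
    where
  th := Subtype.val
  val B T := ¬ (logic P A).IsClosed B T
  isPrime := Subtype.prop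
  isClosed := not_not.1
  exists_of_notMem hT h := by
    obtain ⟨T', h₁, h₂, h₃, -⟩ := hT.exists_prime_of_notMem h
    exact ⟨⟨T', h₂⟩, h₁, h₃⟩
  exists_of_say_notMem hT h := by
    obtain ⟨T', h₁, h₂, h₃, h₄⟩ := hT.exists_prime_isClosed h
    exact ⟨⟨T', h₂⟩, h₁, not_not.2 h₃, h₄⟩

theorem provable_of_entails {s : ICL P A}
    (h : HenkinEntails {Modal.axR, Modal.axT} (ICL.val s)) : ICL.Provable s :=
  (canonical P A).pr_of_entails _ (canonical P A).val
    (fun _ w => (Form.holds_embed_iff _ (fun _ _ => Iff.rfl) s w).1) h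

end ICL

namespace ICLB

open AccessLogic Provable

variable {P A : Type u}

/-- `ICL^B` as an access control logic. -/
abbrev logic (P A : Type u) : AccessLogic (Prin A) (Form P (Prin A)) :=
  Form.logic (fun s : Form P (Prin A) => ICLB.Provable s) .ax .mp

/-! ### Boolean order on principals and the prime ideal argument. -/

variable {T : Set (Form P (Prin A))} {s : Form P (Prin A)} {B C : Prin A}

theorem say_of_top (hT : (logic P A).IsTheory T) (h : ∀ v, B.eval v) : Form.say B s ∈ T :=
  hT.app (s := Form.say B Form.bot) 
    ((isTheory_setOf_pr (L := logic P A)).say_mono (ax (.botElim s)))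
    (hT.thm (untrust B fun v => iff_of_true (h v) trivial))

/-- Here `B ⊃ C` is a tautology, so it says everything, and `cuc'` applies. -/
theorem say_mono_left (hT : (logic P A).IsTheory T) (h : ∀ v, B.eval v → C.eval v)
    (hB : Form.say B s ∈ T) : Form.say C s ∈ T :=
  hT.app₂ (cuc' B C s) (say_of_top hT h) hB

/-- A set of principals closed downwards in the Boolean order and under disjunction. -/
structure IsIdeal (J : Set (Prin A)) : Prop where
  down : ∀ {B C : Prin A}, C ∈ J → (∀ v, B.eval v → C.eval v) → B ∈ J
  or : ∀ {B C : Prin A}, B ∈ J → C ∈ J → Prin.or B C ∈ J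

/-- If `T` does not contain `B says s`, then there is a valuation that makes `B` false and such
that `T` does not contain `C says s` for any `C` that it makes false. -/
theorem exists_valuation (hT : (logic P A).IsTheory T) (hs : Form.say B s ∉ T) :
    ∃ v : A → Prop, ¬ B.eval v ∧ ∀ C : Prin A, ¬ C.eval v → Form.say C s ∉ T := by
  obtain ⟨J, hBJ, hJ⟩ := zorn_subset_nonempty
    {J : Set (Prin A) | IsIdeal J ∧ ∀ C ∈ J, Form.say C s ∉ T}
    (by
      intro c hc hchain hcne
      refine ⟨⋃₀ c, ⟨⟨?_, ?_⟩, ?_⟩, fun X hX => Set.subset_sUnion_of_mem hX⟩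
      · rintro B C ⟨X, hX, hC⟩ h
        exact ⟨X, hX, (hc hX).1.down hC h⟩
      · rintro B C ⟨X, hX, hB⟩ ⟨Y, hY, hC⟩
        rcases hchain.total hX hY with h | h
        · exact ⟨Y, hY, (hc hY).1.or (h hB) hC⟩
        · exact ⟨X, hX, (hc hX).1.or hB (h hC)⟩
      · rintro C ⟨X, hX, h⟩
        exact (hc hX).2 C h)
    -- The principal ideal of `B`, which avoids the filter because `B says s` is missing.
    {C | ∀ v, C.eval v → B.eval v}
    ⟨⟨fun hC h v hv => hC v (h v hv), fun hB hC v => Or.rec (hB v) (hC v)⟩,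
      fun C hC h => hs (say_mono_left hT hC h)⟩
  obtain ⟨hI, hJs⟩ := hJ.prop
  have hB : B ∈ J := hBJ fun _ h => h
  have htop : Prin.top ∉ J := fun h => hJs _ h (say_of_top hT fun _ => trivial)
  -- Otherwise the ideal generated by `J` and `C` would contradict maximality.
  have key : ∀ C ∉ J, ∃ E ∈ J, Form.say (Prin.or E C) s ∈ T := by
    intro C hC
    by_contra! hcon
    refine hC (hJ.le_of_ge (y := {D | ∃ E ∈ J, ∀ v, D.eval v → E.eval v ∨ C.eval v})
      ⟨⟨?_, ?_⟩, ?_⟩ (fun D hD => ⟨D, hD, fun _ => Or.inl⟩) ⟨B, hB, fun _ => Or.inr⟩)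
    · rintro D D' ⟨E, hE, h⟩ h'
      exact ⟨E, hE, fun v hv => h v (h' v hv)⟩
    · rintro D D' ⟨E, hE, h⟩ ⟨E', hE', h'⟩
      refine ⟨_, hI.or hE hE', fun v hv => ?_⟩
      have := h v
      have := h' v
      simp only [Prin.eval] at hv ⊢
      tauto
    · rintro D ⟨E, hE, h⟩ hD
      exact hcon E hE (say_mono_left hT h hD)
  -- If `C` and its negation were both outside `J`, then `E ∨ C` and `E' ∨ ¬C` would both say `s`.
  -- Since `E' ∨ ¬C` entails `(E ∨ C) ⊃ (E ∨ E')`, `cuc'` would make `E ∨ E'`, a member of `J`, say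
  -- `s`.
  have hprime : ∀ C ∉ J, Prin.imp C Prin.bot ∈ J := by
    intro C hC
    by_contra hC'
    obtain ⟨E, hE, h⟩ := key C hC
    obtain ⟨E', hE', h'⟩ := key _ hC'
    refine hJs _ (hI.or hE hE') (hT.app₂ (cuc' (Prin.or E C) _ s)
      (say_mono_left hT (fun v => ?_) h') h)
    simp only [Prin.eval]
    tauto
  have heval : ∀ C : Prin A, C.eval (fun a => Prin.atom a ∉ J) ↔ C ∉ J := by
    intro C
    induction C with
    | atom a => exact Iff.rfl
    | and C D hC hD =>
      refine (and_congr hC hD).trans ⟨fun h hCD => h.2 ?_, fun h => ⟨?_, ?_⟩⟩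
      · refine hI.down (hI.or (hprime C h.1) hCD) fun v => ?_
        simp only [Prin.eval]
        tauto
      · exact fun hC => h (hI.down hC fun _ => And.left)
      · exact fun hD => h (hI.down hD fun _ => And.right)
    | or C D hC hD =>
      refine (or_congr hC hD).trans ⟨?_, fun h => ?_⟩
      · rintro (h | h) hCD
        · exact h (hI.down hCD fun _ => Or.inl)
        · exact h (hI.down hCD fun _ => Or.inr)
      · by_contra! hcon
        exact h (hI.or hcon.1 hcon.2)
    | imp C D hC hD =>
      refine (imp_congr hC hD).trans ⟨fun h hCD => ?_, fun h hC hD => ?_⟩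
      · have hD : D ∈ J := hI.down hCD fun _ hv _ => hv
        -- `C ∨ (C ⊃ D)` is a classical tautology, so it cannot lie in `J`.
        refine h (fun hC => htop (hI.down (hI.or hC hCD) fun v _ => ?_)) hD
        simp only [Prin.eval]
        tauto
      · refine h (hI.down (hI.or (hprime C hC) hD) fun v => ?_)
        simp only [Prin.eval]
        tauto
    | bot => exact iff_of_false id (not_not.2 (hI.down hB fun _ => False.elim))
    | top => exact iff_of_true trivial htop
  refine ⟨_, fun h => (heval B).1 h hB, fun C hC => hJs C ?_⟩
  by_contra hcon
  exact hC ((heval C).2 hcon)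

/-- Prime theories with a valuation of the atomic principals such that the theory is closed under
each principal that is false. -/
def World (P A : Type u) : Type u :=
  {w : Set (Form P (Prin A)) × (A → Prop) //
    (logic P A).IsPrime w.1 ∧ ∀ C : Prin A, ¬ C.eval w.2 → (logic P A).IsClosed C w.1}

/-- With the valuation fixed first, the formulas `C says s` for false `C` are avoided
simultaneously. They are directed because a disjunction of false principals is false. -/
theorem exists_world (hT : (logic P A).IsTheory T) (hs : Form.say B s ∉ T) :
    ∃ w : World P A, T ⊆ w.1.1 ∧ ¬ B.eval w.1.2 ∧ s ∉ w.1.1 := by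
  obtain ⟨v, hB, hv⟩ := exists_valuation hT hs
  obtain ⟨T', hTT', hT', hU, hmax⟩ := hT.exists_prime
    (U := {t | ∃ C : Prin A, ¬ C.eval v ∧ t = Form.say C s}) ⟨_, B, hB, rfl⟩
    (by
      rintro _ ⟨C, hC, rfl⟩ _ ⟨D, hD, rfl⟩
      refine ⟨_, ⟨Prin.or C D, not_or.2 ⟨hC, hD⟩, rfl⟩, ?_, ?_⟩
      · exact say_mono_left (isTheory_setOf_pr.insert (L := logic P A) _)
          (fun _ => Or.inl)
          (isTheory_setOf_pr.imp_self (L := logic P A) (Form.say C s))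
      · exact say_mono_left (isTheory_setOf_pr.insert (L := logic P A) _)
          (fun _ => Or.inr)
          (isTheory_setOf_pr.imp_self (L := logic P A) (Form.say D s)))
    (by rintro _ ⟨C, hC, rfl⟩; exact hv C hC)
  refine ⟨⟨(T', v), hT', fun C hC t ht => ?_⟩, hTT', hB,
    fun h => hU _ ⟨B, hB, rfl⟩ (hT'.app (ax (.unit B s)) h)⟩
  by_contra hcon
  obtain ⟨_, ⟨D, hD, rfl⟩, hDt⟩ := hmax t hcon
  -- `C says t` and `t ⊃ D says s` involve different principals. Weakening both to `C ∨ D` makes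
  -- `idem` applicable.
  refine hU _ ⟨Prin.or C D, not_or.2 ⟨hC, hD⟩, rfl⟩ (hT'.app (ax (.idem (Prin.or C D) s)) ?_)
  refine hT'.mp (hT'.say_mono (hT'.imp_trans hDt ?_)) (say_mono_left hT'.toIsTheory
    (fun _ => Or.inl) ht)
  exact hT'.thm (say_mono_left (isTheory_setOf_pr.insert (L := logic P A) _)
          (fun _ => Or.inr)
          (isTheory_setOf_pr.imp_self (L := logic P A) (Form.say D s)))

/-- The canonical model of `ICL^B`. -/
def canonical (P A : Type u) : (logic P A).Canonical (World P A) where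
  th w := w.1.1
  val B w := B.eval w.1.2
  isPrime w := w.2.1
  isClosed {B w} h := w.2.2 B h
  exists_of_notMem {T s} hT h := by
    -- By `trust`, a missing `s` means a missing `⊥ says s`.
    obtain ⟨w, h₁, -, h₂⟩ := exists_world (B := Prin.bot) hT fun h' => h (hT.app (trust s) h')
    exact ⟨w, h₁, h₂⟩
  exists_of_say_notMem := exists_world

theorem provable_of_entails {s : ICLB P A}
    (h : HenkinEntails {Modal.axR, Modal.axT} (ICLB.val s)) : ICLB.Provable s :=
  (canonical P A).pr_of_entails _ (fun a w => w.1.2 a)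
    (fun _ w => (Form.holds_embed_iff _ (fun _ _ => Standard.holds_prin) s w).1) h

end ICLB

/-! ## Completeness of `ICL^⇒` -/

namespace ICLSF

open AccessLogic Standard

variable {P A : Type u}

/-- `ICL^⇒` as an access control logic. -/
def logic (P A : Type u) : AccessLogic A (ICLSF P A) where
  imp := imp
  and := and
  or := or
  bot := bot
  top := top
  say := say
  Pr := Provable
  mp := .mp
  k := .k
  s := .s
  andIntro := .andIntro
  andLeft := .andLeft
  andRight := .andRight
  orLeft := .orLeft
  orRight := .orRight
  orElim := .orElim
  botElim := .botElim
  topIntro := .topIntro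
  unit := .unit
  cuc := .cuc
  idem := .idem

/-- Prime theories with a valuation of the principals such that the theory is closed under each
principal that is false, and the valuation respects the speaks-for formulas of the theory. -/
def World (P A : Type u) : Type u :=
  {w : Set (ICLSF P A) × (A → Prop) //
    (logic P A).IsPrime w.1 ∧ (∀ C, ¬ w.2 C → (logic P A).IsClosed C w.1) ∧
      ∀ B C, speaksFor B C ∈ w.1 → w.2 B → w.2 C}

/-- The world that makes those principals false that speak for `C`. -/
def worldOf {T : Set (ICLSF P A)} {C : A} (hT : (logic P A).IsPrime T)
    (hC : (logic P A).IsClosed C T) : World P A :=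
  ⟨(T, fun B => speaksFor B C ∉ T), hT,
    fun B hB t ht => hC t (hT.app₂ (.speakingFor B C t) (not_not.1 hB) ht),
    fun B D hBD hB hD => hB (hT.app₂ (.trans B D C) hBD hD)⟩

/-- The canonical model of `ICL^⇒`. -/
def canonical (P A : Type u) : (logic P A).Canonical (World P A) where
  th w := w.1.1
  val B w := w.1.2 B
  isPrime w := w.2.1
  isClosed {B w} h := w.2.2.1 B h
  exists_of_notMem {T s} hT h := by
    obtain ⟨T', h₁, h₂, h₃, -⟩ := hT.exists_prime_of_notMem h
    -- Making all principals true imposes no closure condition on the theory.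
    exact ⟨⟨(T', fun _ => True), h₂, fun _ h => (h trivial).elim, fun _ _ _ => id⟩, h₁, h₃⟩
  exists_of_say_notMem {T B s} hT h := by
    obtain ⟨T', h₁, h₂, h₃, h₄⟩ := hT.exists_prime_isClosed h
    exact ⟨worldOf h₂ h₃, h₁, not_not.2 (h₂.thm (.refl B)), h₄⟩

/-- If `B ⇒ C` is missing, so is `C says (B ⇒ C)`, by `handoff`. A larger prime theory closed under
`C` then omits `B ⇒ C`, and `worldOf` makes `B` true and `C` false there. -/
theorem speaksFor_mem_iff {B C : A} {w : World P A} :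
    speaksFor B C ∈ (canonical P A).th w ↔
      ∀ v, (canonical P A).th w ⊆ (canonical P A).th v →
        (canonical P A).val B v → (canonical P A).val C v := by
  refine ⟨fun h v hv => v.2.2.2 B C (hv h), fun h => ?_⟩
  by_contra hcon
  have hw := w.2.1.toIsTheory
  obtain ⟨T', h₁, h₂, h₃, h₄⟩ := hw.exists_prime_isClosed (B := C) (s := speaksFor B C)
    fun h' => hcon (hw.app (.handoff B C) h')
  exact h (worldOf h₂ h₃) h₁ h₄ (h₂.thm (.refl C))

theorem holds_embed_iff [Nonempty (World P A)] {φ : (frame (World P A)).Assignment}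
    (s : ICLSF P A) (w : World P A) :
    Holds (fun w v => (canonical P A).th w ⊆ (canonical P A).th v)
      (fun p w => atom p ∈ (canonical P A).th w) (canonical P A).val φ w s.embed ↔
      s ∈ (canonical P A).th w := by
  induction s generalizing w with
  | atom p => exact holds_eAtom.trans (canonical P A).forall_mem_iff.symm
  | and s t hs ht => exact holds_eAnd.trans ((and_congr (hs w) (ht w)).trans w.2.1.and_mem_iff.symm)
  | or s t hs ht => exact holds_eOr.trans ((or_congr (hs w) (ht w)).trans w.2.1.or_mem_iff.symm)
  | imp s t hs ht =>
    exact holds_eImp.trans ((forall₂_congr fun v _ => imp_congr (hs v) (ht v)).trans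
      (canonical P A).imp_mem_iff.symm)
  | bot => exact iff_of_false not_holds_mBot w.2.1.bot_notMem
  | top => exact iff_of_true holds_mTop (w.2.1.thm .topIntro)
  | say B s hs =>
    exact holds_eSays.trans ((forall₂_congr fun v _ => or_congr holds_princ (hs v)).trans
      (canonical P A).say_mem_iff.symm)
  | speaksFor B C =>
    exact holds_eSpeaksFor.trans ((forall₂_congr fun v _ => imp_congr holds_princ holds_princ).trans
      speaksFor_mem_iff.symm)

theorem provable_of_entails {s : ICLSF P A}
    (h : HenkinEntails {Modal.axR, Modal.axT} (ICLSF.val s)) : ICLSF.Provable s :=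
  (canonical P A).pr_of_entails _ (canonical P A).val
    (fun _ w => (holds_embed_iff s w).1) h

end ICLSF

theorem mainTheorem3 {P A : Type u} :
    (∀ s : ICL P A,
      HenkinEntails {Modal.axR, Modal.axT} (ICL.val s) → ICL.Provable s) ∧
    (∀ s : ICLSF P A,
      HenkinEntails {Modal.axR, Modal.axT} (ICLSF.val s) → ICLSF.Provable s) ∧
    (∀ s : ICLB P A,
      HenkinEntails {Modal.axR, Modal.axT} (ICLB.val s) → ICLB.Provable s) :=
  ⟨fun _ => ICL.provable_of_entails, fun _ => ICLSF.provable_of_entails,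
    fun _ => ICLB.provable_of_entails⟩
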